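/- \textbf{Setting.} A game $G=(S_1,S_2,E,w)$ consists of disjoint finite sets $S_1,S_2$ of states of players 1 and 2, with $S=S_1\uplus S_2$, edges $E\subseteq S\times S$ such that every state has an outgoing edge, and integer weights $w\colon E\to\mathbb Z$; $W$ denotes the largest absolute value of a weight. $G$ is one-player if $S_1=\emptyset$ or $S_2=\emptyset$. A play is an infinite path $\rho=s_0s_1\ldots$, with energy levels $\mathrm{EL}(\rho(n))=\sum_{i=0}^{n-1}w(s_i,s_{i+1})$ and average-energy $\overline{\mathrm{AE}}(\rho)=\limsup_{n\to\infty}\frac1n\sum_{i=1}^{n}\mathrm{EL}(\rho(i))$. For $t\in\mathbb Q$, the $AE_L$ objective of player 1 is the set of plays $\rho$ with $\mathrm{EL}(\rho(n))\ge 0$ for all $n\ge 0$ and $\overline{\mathrm{AE}}(\rho)\le t$. A strategy of player $i$ maps each prefix of a play ending in $S_i$ to a successor of its last state; a strategy of player 1 (player 2) is winning from $s_0$ if, against every strategy of the opponent, the unique play from $s_0$ consistent with both strategies belongs (does not belong) to the objective. A strategy has memory $k$ if it is given by a deterministic Moore machine with $k$ memory states $M$, initial state $m_0\in M$, update function $M\times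 S\to M$ and next-move function $M\times S\to S$: on a prefix $s_0\ldots s_n$ it applies the next-move function to $s_n$ and the memory state reached after reading $s_0\ldots s_{n-1}$. It is memoryless if it depends only on the current state. \textbf{Theorem.} \begin{enumerate} \item (Pseudo-polynomial memory suffices for player 1.) There is a polynomial $p$ in three variables with coefficients in $\mathbb N$ such that for every one-player game $G$, initial state $s_0$ and threshold $t\in\mathbb Q$: if player 1 has a winning strategy from $s_0$ for the $AE_L$ objective with threshold $t$, then player 1 has a winning strategy of memory at most $p(|S|,W,\max(\lceil t\rceil,0))$. \item (Pseudo-polynomial memory is necessary for player 1.) For every integer $U\ge 1$ there are a game with $|S|=2$, $S_2=\emptyset$ and $W=U$, and an initial state, such that for the threshold $t=\frac{U(U+1)}{2U+1}$ player 1 has a winning strategy for the $AE_L$ objective, and every finite-memory winning strategy of player 1 has memory at least $U+1$. \item (Memoryless strategies suffice for player 2.) For every one-player game, initial state and threshold $t\in\mathbb Q$: if player 2 has a winning strategy against the $AE_L$ objective, then player 2 has a memoryless winning strategy. \end{enumerate} -/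

import Mathlib

namespace AvgEnergy

/-- The two players. -/
inductive Player
  | one
  | two

/-- A weighted turn-based game graph on the state set `S`: `owner` gives the partition
`S = S₁ ⊎ S₂`. The weight function is only ever evaluated on edges. Every state has an outgoing
edge, so that strategies and infinite plays make sense. -/
structure Game (S : Type*) where
  owner : S → Player
  edge : S → S → Prop
  weight : S → S → ℤ
  total : ∀ s, ∃ s', edge s s'

namespace Game

variable {S : Type*}

/-- The set of states that belong to player `i`. -/
def states (G : Game S) (i : Player) : Set S := {s | G.owner s = i}

/-- A game is one-player if one of the two players owns no state. -/
def OnePlayer (G : Game S) : Prop := G.states .one = ∅ ∨ G.states .two = ∅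

open Classical in
/-- The largest absolute weight of an edge. -/
noncomputable def maxWeight [Fintype S] (G : Game S) : ℕ :=
  (Finset.univ.filter fun e : S × S => G.edge e.1 e.2).sup fun e => (G.weight e.1 e.2).natAbs

/-- A play: an infinite path in the game graph. -/
structure Play (G : Game S) where
  state : ℕ → S
  step : ∀ n, G.edge (state n) (state (n + 1))

variable {G : Game S}

/-- The prefix `s₀ s₁ … sₙ` of a play up to position `n`. -/
def Play.pref (ρ : G.Play) (n : ℕ) : List S := (List.range (n + 1)).map ρ.state

/-- The energy level `EL(ρ(n))`, for initial energy `0`. -/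
def Play.energy (ρ : G.Play) (n : ℕ) : ℤ :=
  ∑ i ∈ Finset.range n, G.weight (ρ.state i) (ρ.state (i + 1))

/-- The average-energy `limsup (1/n) ∑_{i=1}^n EL(ρ(i))`, as an extended real number. -/
noncomputable def Play.avgEnergy (ρ : G.Play) : EReal :=
  Filter.limsup
    (fun n : ℕ => (((1 / (n : ℝ)) * ∑ i ∈ Finset.Icc 1 n, (ρ.energy i : ℝ) : ℝ) : EReal))
    Filter.atTop

variable (G) in
/-- A strategy of player `i` maps each prefix that belongs to player `i` to a successor of its last
state. The values of `move` on other lists are irrelevant. -/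
structure Strategy (i : Player) where
  move : List S → S
  valid : ∀ (ρ : G.Play) (n : ℕ), G.owner (ρ.state n) = i → G.edge (ρ.state n) (move (ρ.pref n))

/-- Consistency of a play with a strategy. -/
def Play.Consistent {i : Player} (ρ : G.Play) (σ : G.Strategy i) : Prop :=
  ∀ n, G.owner (ρ.state n) = i → σ.move (ρ.pref n) = ρ.state (n + 1)

/-- Every state sequence that is a path up to position `n` agrees up to `n` with some play. -/
theorem exists_play_extending (G : Game S) (r : ℕ → S) (n : ℕ)
    (h : ∀ i < n, G.edge (r i) (r (i + 1))) :
    ∃ ρ : G.Play, ∀ i ≤ n, ρ.state i = r i := by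
  choose f hf using G.total
  refine ⟨⟨fun i => if i ≤ n then r i else f^[i - n] (r n), fun i => ?_⟩, fun i hi => by simp [hi]⟩
  rcases lt_trichotomy i n with hi | rfl | hi
  · simpa [hi.le, Nat.succ_le_of_lt hi] using h i hi
  · simpa using hf (r i)
  · have h1 : ¬ i ≤ n := by omega
    have h2 : ¬ i + 1 ≤ n := by omega
    have h3 : i + 1 - n = (i - n) + 1 := by omega
    simp only [h1, h2, if_false, h3, Function.iterate_succ_apply']
    exact hf _

open Classical in
/-- Given strategies of both players, there is exactly one play from `s₀` consistent with both. -/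
theorem existsUnique_outcome (s₀ : S) (σ₁ : G.Strategy .one) (σ₂ : G.Strategy .two) :
    ∃! ρ : G.Play, ρ.state 0 = s₀ ∧ ρ.Consistent σ₁ ∧ ρ.Consistent σ₂ := by
  let mv : S → List S → S := fun s h => if G.owner s = .one then σ₁.move h else σ₂.move h
  let c : ℕ → List S × S := fun n =>
    Nat.rec ([], s₀) (fun _ p => (p.1 ++ [p.2], mv p.2 (p.1 ++ [p.2]))) n
  let r : ℕ → S := fun n => (c n).2
  have hc : ∀ n, (c n).1 = (List.range n).map r := by
    intro n
    induction n with
    | zero => rfl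
    | succ n ih =>
      rw [List.range_succ, List.map_append, ← ih]
      rfl
  have hr : ∀ n, r (n + 1) = mv (r n) ((List.range (n + 1)).map r) := by
    intro n
    have : r (n + 1) = mv (r n) ((c n).1 ++ [r n]) := rfl
    rw [this, hc, List.range_succ, List.map_append]
    rfl
  have hpref : ∀ (ρ : G.Play) n, (∀ i ≤ n, ρ.state i = r i) →
      ρ.pref n = (List.range (n + 1)).map r := by
    intro ρ n h
    refine List.map_congr_left fun i hi => h i ?_
    have := List.mem_range.1 hi
    omega
  have hstep : ∀ n, G.edge (r n) (r (n + 1)) := by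
    intro n
    induction n using Nat.strong_induction_on with
    | _ n ih =>
      obtain ⟨ρ, hρ⟩ := G.exists_play_extending r n ih
      rw [hr, ← hpref ρ n hρ, ← hρ n le_rfl]
      by_cases ho : G.owner (ρ.state n) = .one
      · simpa [mv, ho] using σ₁.valid ρ n ho
      · have ho2 : G.owner (ρ.state n) = .two := by
          cases h : G.owner (ρ.state n)
          · exact absurd h ho
          · rfl
        simpa [mv, ho2] using σ₂.valid ρ n ho2
  refine ⟨⟨r, hstep⟩, ⟨rfl, fun n hn => ?_, fun n hn => ?_⟩, ?_⟩
  · simp only at hn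
    simp only [hr, mv, hn, if_true]
    rfl
  · simp only at hn
    simp only [hr, mv, hn, reduceCtorEq, if_false]
    rfl
  · rintro ⟨q, hq⟩ ⟨h0, h1, h2⟩
    have key : ∀ n, ∀ i ≤ n, q i = r i := by
      intro n
      induction n with
      | zero =>
        intro i hi
        obtain rfl : i = 0 := by omega
        exact h0
      | succ n ih =>
        intro i hi
        rcases Nat.lt_or_ge i (n + 1) with h | h
        · exact ih i (by omega)
        · obtain rfl : i = n + 1 := by omega
          rw [hr, ← hpref ⟨q, hq⟩ n ih, ← ih n le_rfl]
          by_cases ho : G.owner (q n) = .one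
          · simpa [mv, ho] using (h1 n ho).symm
          · have ho2 : G.owner (q n) = .two := by
              cases h : G.owner (q n)
              · exact absurd h ho
              · rfl
            simpa [mv, ho2] using (h2 n ho2).symm
    have : q = r := funext fun n => key n n le_rfl
    subst this
    rfl

/-- The unique play from `s₀` that is consistent with both strategies. -/
noncomputable def outcome (s₀ : S) (σ₁ : G.Strategy .one) (σ₂ : G.Strategy .two) : G.Play :=
  (existsUnique_outcome s₀ σ₁ σ₂).choose

/-- `σ₁` is winning for player 1 from `s₀` for the objective `Obj`. -/
def WinsOne (s₀ : S) (Obj : Set G.Play) (σ₁ : G.Strategy .one) : Prop :=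
  ∀ σ₂ : G.Strategy .two, outcome s₀ σ₁ σ₂ ∈ Obj

/-- `σ₂` is winning for player 2 from `s₀` when player 1 has the objective `Obj`. -/
def WinsTwo (s₀ : S) (Obj : Set G.Play) (σ₂ : G.Strategy .two) : Prop :=
  ∀ σ₁ : G.Strategy .one, outcome s₀ σ₁ σ₂ ∉ Obj

/-- Lower-bounded energy objective with initial energy level `c`. -/
def lowerBounded (G : Game S) (c : ℕ) : Set G.Play := {ρ | ∀ n, 0 ≤ (c : ℤ) + ρ.energy n}

/-- Average-energy objective with threshold `t`. -/
def avgEnergyLevel (G : Game S) (t : ℚ) : Set G.Play := {ρ | ρ.avgEnergy ≤ (((t : ℝ)) : EReal)}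

/-- The `AEL` objective: energy never below zero, from initial energy zero, and average-energy at
most `t`. -/
def AEL (G : Game S) (t : ℚ) : Set G.Play := G.lowerBounded 0 ∩ G.avgEnergyLevel t

end Game

/-- A deterministic Moore machine with memory set `M` that reads the visited states one by one; the
next move is chosen from the current memory and the current state. -/
structure MooreMachine (S M : Type*) where
  init : M
  update : M → S → M
  next : M → S → S

namespace Game

variable {S : Type*} {G : Game S}

/-- The strategy `σ` is encoded by the machine `A`: on a prefix `s₀ … sₙ` of player `i` it plays
`A.next m sₙ`, where `m` is the memory after reading `s₀ … sₙ₋₁`. -/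
def Strategy.EncodedBy {i : Player} (σ : G.Strategy i) {M : Type*} (A : MooreMachine S M) : Prop :=
  ∀ (ρ : G.Play) (n : ℕ), G.owner (ρ.state n) = i →
    σ.move (ρ.pref n) =
      A.next (((List.range n).map ρ.state).foldl A.update A.init) (ρ.state n)

/-- The strategy `σ` can be encoded by a Moore machine with `k` memory states. -/
def Strategy.HasMemory {i : Player} (σ : G.Strategy i) (k : ℕ) : Prop :=
  ∃ A : MooreMachine S (Fin k), σ.EncodedBy A

/-- The strategy `σ` depends only on the current state. -/
def Strategy.Memoryless {i : Player} (σ : G.Strategy i) : Prop :=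
  ∃ f : S → S, ∀ (ρ : G.Play) (n : ℕ), G.owner (ρ.state n) = i → σ.move (ρ.pref n) = f (ρ.state n)

end Game

end AvgEnergy

/-!
A finite sequence of weighted steps containing a cycle of positive cost yields, after shortening, a
stem and a cycle without repeated vertices, hence a *function* on the vertices whose orbit has
accumulated cost tending to infinity. Both positive results apply this to a suitable graph.

Player 1: if a play of nonnegative energy has average-energy less than `τ`, the accumulated gap
`τ - EL` tends to infinity, and since only finitely many configurations (state, energy) lie below
`τ`, some configuration recurs with positive accumulated gap. The energy on the way can be bounded:
a walk that climbs far above `τ` climbs and descends through more levels than there are pairs of end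
configurations relative to the level, so a part of the ascent and the matching part of the descent
can be cut out. This gives memory (state, bounded energy) for each threshold above `t`.

Player 2: a play violating the objective has negative energy somewhere, or visits a state with two
different energies, or its energy is a function of the state, which turns average-energy into
mean-payoff. In each case a simple path or a simple lasso in the game graph suffices.

For the lower bound, player 1 must gain `U` by `U` turns of a cycle before paying `U` on a loop that
starts at the same state, so the machine has to count.
-/

namespace AvgEnergy

open Finset Filter

section PeriodicSums

variable {M : Type*} {φ : ℕ → M} {q : ℕ}

theorem sum_range_of_periodic [AddCommMonoid M] (hφ : Function.Periodic φ q) (n : ℕ) :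
    ∑ i ∈ range n, φ i = (n / q) • ∑ i ∈ range q, φ i + ∑ i ∈ range (n % q), φ i := by
  have add_mul_period : ∀ k m, ∑ i ∈ range (k * q + m), φ i =
      k • ∑ i ∈ range q, φ i + ∑ i ∈ range m, φ i := by
    intro k m
    induction k with
    | zero => simp
    | succ k ih =>
      rw [show (k + 1) * q + m = q + (k * q + m) by ring, sum_range_add, succ_nsmul', add_assoc,
        ← ih]
      simp only [add_comm q, hφ _]
  rw [← add_mul_period, Nat.div_add_mod']

theorem finite_range_sum_mod [AddCommMonoid M] (hq : q ≠ 0) (φ : ℕ → M) :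
    (Set.range fun n => ∑ i ∈ range (n % q), φ i).Finite := by
  refine ((Set.finite_Iio q).image fun m => ∑ i ∈ range m, φ i).subset ?_
  rintro _ ⟨n, rfl⟩
  exact ⟨n % q, Nat.mod_lt n (Nat.pos_of_ne_zero hq), rfl⟩

theorem tendsto_sum_range_atTop_of_periodic [AddCommGroup M] [LinearOrder M]
    [IsOrderedAddMonoid M] [Archimedean M] (hφ : Function.Periodic φ q)
    (hpos : 0 < ∑ i ∈ range q, φ i) :
    Tendsto (fun n => ∑ i ∈ range n, φ i) atTop atTop := by
  have hq : q ≠ 0 := by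
    rintro rfl
    simp at hpos
  obtain ⟨c, hc⟩ := (finite_range_sum_mod hq φ).bddBelow
  rw [funext (sum_range_of_periodic hφ)]
  exact tendsto_atTop_add_right_of_le _ c
    ((Nat.tendsto_div_const_atTop hq).atTop_nsmul_const hpos) fun n => hc ⟨n, rfl⟩

theorem bddAbove_range_sum_range_of_periodic [AddCommMonoid M] [LinearOrder M]
    (hφ : Function.Periodic φ q) (hq : q ≠ 0) (hzero : ∑ i ∈ range q, φ i = 0) :
    BddAbove (Set.range fun n => ∑ i ∈ range n, φ i) := by
  simp only [funext (sum_range_of_periodic hφ), hzero, smul_zero, zero_add]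
  exact (finite_range_sum_mod hq φ).bddAbove

end PeriodicSums

section Walks

variable {C M : Type*} {R : C → C → Prop}

/-- There is a walk from `a` to `b` of `k` steps along `R` whose steps have total cost `x`. -/
def HasWalk [AddCommMonoid M] (R : C → C → Prop) (g : C → C → M) (a b : C) (k : ℕ) (x : M) :
    Prop :=
  ∃ r : ℕ → C, r 0 = a ∧ r k = b ∧ (∀ i < k, R (r i) (r (i + 1))) ∧
    ∑ i ∈ range k, g (r i) (r (i + 1)) = x

namespace HasWalk

theorem exists_append [AddCommMonoid M] {g : C → C → M} {a b c : C} {k l : ℕ} {x y : M}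
    (h₁ : HasWalk R g a b k x) (h₂ : HasWalk R g b c l y) :
    ∃ r : ℕ → C, r 0 = a ∧ r k = b ∧ r (k + l) = c ∧ (∀ i < k + l, R (r i) (r (i + 1))) ∧
      ∑ i ∈ range k, g (r i) (r (i + 1)) = x ∧
      ∑ i ∈ range l, g (r (k + i)) (r (k + (i + 1))) = y := by
  obtain ⟨r₁, h0, hk, hR₁, hx⟩ := h₁
  obtain ⟨r₂, h0', hl, hR₂, hy⟩ := h₂
  let r i := if i < k then r₁ i else r₂ (i - k)
  have left : ∀ i ≤ k, r i = r₁ i := by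
    intro i hi
    rcases hi.lt_or_eq with hi | rfl
    · simp [r, hi]
    · simp [r, h0', hk]
  have right : ∀ i, r (k + i) = r₂ i := by simp [r]
  refine ⟨r, (left 0 k.zero_le).trans h0, (left k le_rfl).trans hk, (right l).trans hl,
    fun i hi => ?_, ?_, ?_⟩
  · rcases lt_or_ge i k with hik | hik
    · simpa only [left i hik.le, left (i + 1) hik] using hR₁ i hik
    · obtain ⟨j, rfl⟩ := Nat.exists_eq_add_of_le hik
      simpa only [add_assoc, right] using hR₂ j (by lia)
  · rw [← hx]
    refine sum_congr rfl fun i hi => ?_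
    rw [left i (mem_range.1 hi).le, left (i + 1) (mem_range.1 hi)]
  · simp only [right, hy]

theorem trans [AddCommMonoid M] {g : C → C → M} {a b c : C} {k l : ℕ} {x y : M}
    (h₁ : HasWalk R g a b k x) (h₂ : HasWalk R g b c l y) :
    HasWalk R g a c (k + l) (x + y) := by
  obtain ⟨r, h0, -, hkl, hR, hx, hy⟩ := h₁.exists_append h₂
  exact ⟨r, h0, hkl, hR, by rw [sum_range_add, hx, ← hy]; rfl⟩

theorem of_segment [AddCommMonoid M] (g : C → C → M) (r : ℕ → C) {m n : ℕ} (hmn : m ≤ n)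
    (hr : ∀ i, m ≤ i → i < n → R (r i) (r (i + 1))) :
    HasWalk R g (r m) (r n) (n - m) (∑ i ∈ Ico m n, g (r i) (r (i + 1))) := by
  refine ⟨fun i => r (m + i), rfl, by simp only [Nat.add_sub_of_le hmn],
    fun i hi => hr (m + i) (by lia) (by lia), ?_⟩
  rw [sum_Ico_eq_sum_range]
  rfl

theorem neg [AddCommGroup M] {g : C → C → M} {a b : C} {k : ℕ} {x : M} (h : HasWalk R g a b k x) :
    HasWalk R (fun c c' => -g c c') a b k (-x) := by
  obtain ⟨r, h0, hk, hR, hx⟩ := h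
  exact ⟨r, h0, hk, hR, by rw [sum_neg_distrib, hx]⟩

end HasWalk

/-- A walk from `s` to a cycle of positive cost, closed after `n` steps in total. -/
def HasPositiveLasso [AddCommMonoid M] [LT M] (R : C → C → Prop) (g : C → C → M) (s : C)
    (n : ℕ) : Prop :=
  ∃ b p q x y, HasWalk R g s b p x ∧ HasWalk R g b b q y ∧ 0 < y ∧ p + q = n

variable [AddCommGroup M] [LinearOrder M] [IsOrderedAddMonoid M] {g : C → C → M} {s : C}

theorem exists_shorter_positiveLasso {r : ℕ → C} {p q i j : ℕ}
    (hR : ∀ i < p + q, R (r i) (r (i + 1))) (hclose : r (p + q) = r p)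
    (hpos : 0 < ∑ n ∈ Ico p (p + q), g (r n) (r (n + 1))) (hij : i < j) (hj : j < p + q)
    (heq : r i = r j) : ∃ m < p + q, HasPositiveLasso R g (r 0) m := by
  have seg : ∀ {i j c}, i ≤ j → j ≤ p + q → r j = c →
      HasWalk R g (r i) c (j - i) (∑ n ∈ Ico i j, g (r n) (r (n + 1))) := by
    rintro i j _ hij hj rfl
    exact .of_segment g r hij fun i _ hi => hR i (by lia)
  rcases le_or_gt j p with hjp | hpj
  · refine ⟨_, ?_, r p, _, _, _, _, (seg i.zero_le (by lia) heq).trans (seg hjp (by lia) rfl),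
      seg (by lia) le_rfl hclose, hpos, rfl⟩
    lia
  rcases lt_or_ge i p with hip | hpi
  · refine ⟨_, ?_, r j, _, _, _, _, seg i.zero_le (by lia) heq,
      (seg hj.le le_rfl hclose).trans (seg hpj.le hj.le rfl), ?_, rfl⟩
    · lia
    · rwa [add_comm, sum_Ico_consecutive _ hpj.le hj.le]
  rcases lt_or_ge 0 (∑ n ∈ Ico i j, g (r n) (r (n + 1))) with hmiddle | hmiddle
  · refine ⟨_, ?_, r i, _, _, _, _, seg i.zero_le (by lia) rfl,
      seg hij.le hj.le heq.symm, hmiddle, rfl⟩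
    lia
  · refine ⟨_, ?_, r p, _, _, _, _, seg p.zero_le (by lia) rfl,
      (seg hpi (by lia) heq).trans (seg hj.le le_rfl hclose), ?_, rfl⟩
    · lia
    · rw [← sum_Ico_consecutive _ hpi (by lia), ← sum_Ico_consecutive _ hij.le hj.le,
        add_left_comm] at hpos
      exact hpos.trans_le (add_le_of_nonpos_left hmiddle)

theorem HasPositiveLasso.exists_injective {n : ℕ} (h : HasPositiveLasso R g s n) :
    ∃ (p q : ℕ) (r : ℕ → C), r 0 = s ∧ r (p + q) = r p ∧ (∀ i < p + q, R (r i) (r (i + 1))) ∧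
      0 < ∑ i ∈ range q, g (r (p + i)) (r (p + (i + 1))) ∧
      Function.Injective fun i : Fin (p + q) => r i := by
  classical
  obtain ⟨n, ⟨b, p, q, x, y, hstem, hcycle, hy, rfl⟩, hmin⟩ :
      ∃ n, HasPositiveLasso R g s n ∧ ∀ m < n, ¬ HasPositiveLasso R g s m :=
    ⟨Nat.find ⟨n, h⟩, Nat.find_spec ⟨n, h⟩, fun _ => Nat.find_min ⟨n, h⟩⟩
  obtain ⟨r, rfl, rfl, hclose, hR, -, rfl⟩ := hstem.exists_append hcycle
  refine ⟨p, q, r, rfl, hclose, hR, hy, ?_⟩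
  refine .of_lt_imp_ne fun i j hij heq => ?_
  obtain ⟨m, hm, hlasso⟩ := exists_shorter_positiveLasso (g := g) hR hclose
    (by rwa [sum_Ico_eq_sum_range, Nat.add_sub_cancel_left]) hij j.2 heq
  exact hmin m hm hlasso

theorem exists_map_eq_succ_of_injective {r : ℕ → C} {n : ℕ}
    (hinj : Function.Injective fun i : Fin n => r i) (hR : ∀ i < n, R (r i) (r (i + 1)))
    (f₀ : C → C) :
    ∃ f : C → C, (∀ i < n, f (r i) = r (i + 1)) ∧ ∀ c, R c (f₀ c) → R c (f c) := by
  classical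
  let f := Function.extend (fun i : Fin n => r i) (fun i => r (i + 1)) f₀
  have hf : ∀ i < n, f (r i) = r (i + 1) := fun i hi => hinj.extend_apply _ f₀ ⟨i, hi⟩
  refine ⟨f, hf, fun c hc => ?_⟩
  by_cases hmem : ∃ i : Fin n, r i = c
  · obtain ⟨i, rfl⟩ := hmem
    exact hf i i.2 ▸ hR i i.2
  · rwa [show f c = f₀ c from Function.extend_apply' _ _ _ hmem]

theorem iterate_eq_of_map_eq_succ {f : C → C} {r : ℕ → C} {n : ℕ}
    (hf : ∀ i < n, f (r i) = r (i + 1)) {i : ℕ} (hi : i ≤ n) : f^[i] (r 0) = r i := by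
  induction i with
  | zero => rfl
  | succ i ih => rw [Function.iterate_succ_apply', ih (by lia), hf i hi]

theorem exists_iterate_eq_of_map_eq_succ {f : C → C} {r : ℕ → C} {p n : ℕ}
    (hf : ∀ i < n, f (r i) = r (i + 1)) (hclose : r n = r p) (hp : p < n) (i : ℕ) :
    ∃ j < n, f^[i] (r 0) = r j := by
  induction i with
  | zero => exact ⟨0, by lia, rfl⟩
  | succ i ih =>
    obtain ⟨j, hj, hij⟩ := ih
    rw [Function.iterate_succ_apply', hij, hf j hj]
    rcases (Nat.succ_le_of_lt hj).lt_or_eq with hlt | heq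
    · exact ⟨j + 1, hlt, rfl⟩
    · exact ⟨p, hp, (congrArg r heq).trans hclose⟩

theorem HasPositiveLasso.exists_iterate_tendsto_atTop [Archimedean M] {n : ℕ}
    (h : HasPositiveLasso R g s n) :
    ∃ f : C → C, (∀ i, R (f^[i] s) (f^[i + 1] s)) ∧
      Tendsto (fun m => ∑ i ∈ range m, g (f^[i] s) (f^[i + 1] s)) atTop atTop := by
  obtain ⟨p, q, r, rfl, hclose, hR, hpos, hinj⟩ := h.exists_injective
  obtain ⟨f, hf, -⟩ := exists_map_eq_succ_of_injective hinj hR id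
  have hiter : ∀ i ≤ p + q, f^[i] (r 0) = r i := fun _ => iterate_eq_of_map_eq_succ hf
  have hperiod : ∀ i, f^[p + (i + q)] (r 0) = f^[p + i] (r 0) := by
    intro i
    rw [show p + (i + q) = i + (p + q) by ring, Function.iterate_add_apply, hiter _ le_rfl, hclose,
      ← hiter p (by lia), ← Function.iterate_add_apply, add_comm i]
  refine ⟨f, fun i => ?_, ?_⟩
  · have hq : q ≠ 0 := by
      rintro rfl
      simp at hpos
    obtain ⟨j, hj, hij⟩ := exists_iterate_eq_of_map_eq_succ hf hclose (by lia) i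
    rw [Function.iterate_succ_apply', hij, hf j hj]
    exact hR j hj
  · rw [← tendsto_add_atTop_iff_nat p]
    simp only [add_comm _ p, sum_range_add]
    refine tendsto_atTop_add_const_left _ _ (tendsto_sum_range_atTop_of_periodic (q := q) ?_ ?_)
    · intro i
      have hnext := hperiod (i + 1)
      rw [add_right_comm] at hnext
      exact congrArg₂ g (hperiod i) hnext
    · convert hpos using 2 with i hi
      rw [mem_range] at hi
      exact congrArg₂ g (hiter _ (by lia)) (hiter _ (by lia))

theorem HasWalk.exists_injective_or_hasPositiveLasso {b : C} {k : ℕ} {x : M}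
    (h : HasWalk R g s b k x) (hx : 0 < x) :
    (∃ (r : ℕ → C) (n : ℕ), r 0 = s ∧ (∀ i < n, R (r i) (r (i + 1))) ∧
      (Function.Injective fun i : Fin n => r i) ∧ 0 < ∑ i ∈ range n, g (r i) (r (i + 1))) ∨
      ∃ n, HasPositiveLasso R g s n := by
  induction k using Nat.strong_induction_on generalizing x with
  | _ k ih =>
    obtain ⟨r, rfl, rfl, hR, rfl⟩ := h
    by_cases hinj : Function.Injective fun i : Fin k => r i
    · exact .inl ⟨r, k, rfl, hR, hinj, hx⟩
    obtain ⟨i, j, hij, hj, heq⟩ : ∃ i j, i < j ∧ j < k ∧ r i = r j := by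
      by_contra! hne
      exact hinj (.of_lt_imp_ne fun i j hij => hne i j hij j.2)
    have seg : ∀ {i j c}, i ≤ j → j ≤ k → r j = c →
        HasWalk R g (r i) c (j - i) (∑ n ∈ Ico i j, g (r n) (r (n + 1))) := by
      rintro i j _ hij hj rfl
      exact .of_segment g r hij fun i _ hi => hR i (by lia)
    rcases lt_or_ge 0 (∑ n ∈ Ico i j, g (r n) (r (n + 1))) with hcycle | hcycle
    · exact .inr ⟨_, r i, _, _, _, _, seg i.zero_le (by lia) rfl,
        seg hij.le hj.le heq.symm, hcycle, rfl⟩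
    · refine ih _ ?_ ((seg i.zero_le (by lia) heq).trans (seg hj.le le_rfl rfl)) ?_
      · lia
      · rw [range_eq_Ico, ← sum_Ico_consecutive _ i.zero_le (by lia),
          ← sum_Ico_consecutive _ hij.le hj.le, add_left_comm] at hx
        exact hx.trans_le (add_le_of_nonpos_left hcycle)

end Walks

theorem exists_return_of_not_bddAbove {C M : Type*} [AddCommGroup M] [LinearOrder M]
    [IsOrderedAddMonoid M] (x : ℕ → C) (φ : C → M)
    (hfin : (Set.range x ∩ {c | 0 < φ c}).Finite)
    (hunbdd : ¬ BddAbove (Set.range fun n => ∑ i ∈ range n, φ (x i))) :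
    ∃ i j, i < j ∧ x i = x j ∧ 0 < φ (x i) ∧ 0 < ∑ n ∈ Ico i j, φ (x n) := by
  classical
  contrapose! hunbdd
  have first_visit : ∀ c, ∃ i, ∀ j, x j = c → i ≤ j ∧ x i = c := fun c => by
    by_cases h : ∃ i, x i = c
    · exact ⟨Nat.find h, fun j hj => ⟨Nat.find_min' h hj, Nat.find_spec h⟩⟩
    · exact ⟨0, fun j hj => (h ⟨j, hj⟩).elim⟩
  choose first hfirst using first_visit
  obtain ⟨D, hD⟩ := (hfin.image fun c => ∑ i ∈ range (first c), φ (x i) + φ c).bddAbove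
  refine ⟨max 0 D, ?_⟩
  rintro _ ⟨n, rfl⟩
  induction n with
  | zero => simp
  | succ n ih =>
    simp only [sum_range_succ]
    rcases le_or_gt (φ (x n)) 0 with hn | hn
    · exact (add_le_of_nonpos_right hn).trans ih
    · obtain ⟨hle, heq⟩ := hfirst _ n rfl
      refine le_max_of_le_right (le_trans ?_ (hD ⟨x n, ⟨⟨n, rfl⟩, hn⟩, rfl⟩))
      rw [add_le_add_iff_right, ← sum_range_add_sum_Ico _ hle]
      refine add_le_of_nonpos_right ?_
      rcases hle.lt_or_eq with hlt | hn'
      · exact hunbdd _ _ hlt heq (heq.symm ▸ hn)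
      · rw [hn', Ico_self, sum_empty]

section AverageEnergy

variable {S : Type*} {G : Game S}

open Game

namespace Game.Play

theorem eq_of_state_eq {ρ π : G.Play} (h : ∀ n, ρ.state n = π.state n) : ρ = π := by
  cases ρ
  cases π
  congr
  exact funext h

theorem energy_zero (ρ : G.Play) : ρ.energy 0 = 0 := by simp [energy]

theorem energy_succ (ρ : G.Play) (n : ℕ) :
    ρ.energy (n + 1) = ρ.energy n + G.weight (ρ.state n) (ρ.state (n + 1)) := by
  simp [energy, sum_range_succ]

theorem sum_Icc_energy (ρ : G.Play) (t : ℝ) (n : ℕ) :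
    ∑ i ∈ Icc 1 n, (ρ.energy i : ℝ) =
      ∑ i ∈ range (n + 1), ((ρ.energy i : ℝ) - t) + (n + 1) * t := by
  rw [sum_sub_distrib, sum_const, card_range, nsmul_eq_mul, range_eq_Ico,
    sum_eq_sum_Ico_succ_bot (by lia), ρ.energy_zero]
  push_cast
  rw [show Ico (0 + 1) (n + 1) = Icc 1 n from rfl]
  ring

theorem avgEnergy_le_of_bddAbove (ρ : G.Play) {t : ℝ}
    (h : BddAbove (Set.range fun n => ∑ i ∈ range n, ((ρ.energy i : ℝ) - t))) :
    ρ.avgEnergy ≤ (t : EReal) := by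
  obtain ⟨D, hD⟩ := h
  have hlim : Tendsto (fun n : ℕ => ((t + (D + t) * (1 / (n : ℝ)) : ℝ) : EReal)) atTop
      (nhds (t : EReal)) := by
    refine (continuous_coe_real_ereal.tendsto _).comp ?_
    simpa using (tendsto_one_div_atTop_nhds_zero_nat.const_mul (D + t)).const_add t
  rw [← hlim.limsup_eq]
  refine limsup_le_limsup ?_
  filter_upwards [eventually_gt_atTop 0] with n hn
  have : (0 : ℝ) < n := by exact_mod_cast hn
  refine EReal.coe_le_coe_iff.2 ?_
  calc 1 / (n : ℝ) * ∑ i ∈ Icc 1 n, (ρ.energy i : ℝ)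
      = 1 / (n : ℝ) * (∑ i ∈ range (n + 1), ((ρ.energy i : ℝ) - t) + (n + 1) * t) := by
        rw [ρ.sum_Icc_energy t n]
    _ ≤ 1 / (n : ℝ) * (D + (n + 1) * t) := by
        gcongr
        exact hD ⟨n + 1, rfl⟩
    _ = t + (D + t) * (1 / (n : ℝ)) := by field_simp; ring

theorem avgEnergy_le_of_tendsto_atTop (ρ : G.Play) {t : ℝ}
    (h : Tendsto (fun n => ∑ i ∈ range n, (t - ρ.energy i)) atTop atTop) :
    ρ.avgEnergy ≤ (t : EReal) := by
  obtain ⟨D, hD⟩ := bddBelow_range_of_tendsto_atTop_atTop h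
  refine ρ.avgEnergy_le_of_bddAbove ⟨-D, ?_⟩
  rintro _ ⟨n, rfl⟩
  rw [le_neg, ← sum_neg_distrib]
  simpa only [neg_sub] using hD ⟨n, rfl⟩

theorem tendsto_atTop_of_avgEnergy_lt (ρ : G.Play) {t : ℝ} (h : ρ.avgEnergy < (t : EReal)) :
    Tendsto (fun n => ∑ i ∈ range n, (t - ρ.energy i)) atTop atTop := by
  obtain ⟨u, hu, hut⟩ := EReal.lt_iff_exists_real_btwn.1 h
  rw [EReal.coe_lt_coe_iff] at hut
  rw [← tendsto_add_atTop_iff_nat 1]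
  have hgrowth : Tendsto (fun n : ℕ => (n : ℝ) * (t - u) + t) atTop atTop :=
    tendsto_atTop_add_const_right _ _
      (tendsto_natCast_atTop_atTop.atTop_mul_const (sub_pos.2 hut))
  refine tendsto_atTop_mono' _ ?_ hgrowth
  filter_upwards [eventually_lt_of_limsup_lt hu, eventually_gt_atTop 0] with n hmean hn
  have hn' : (0 : ℝ) < n := by exact_mod_cast hn
  rw [EReal.coe_lt_coe_iff, one_div, inv_mul_lt_iff₀ hn', ρ.sum_Icc_energy t] at hmean
  simp only [← neg_sub _ t, sum_neg_distrib]
  linarith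

theorem le_avgEnergy_of_tendsto_atTop (ρ : G.Play) {t : ℝ}
    (h : Tendsto (fun n => ∑ i ∈ range n, (ρ.energy i - t)) atTop atTop) :
    (t : EReal) ≤ ρ.avgEnergy := by
  by_contra! hlt
  obtain ⟨n, hpos, hpos'⟩ := ((h.eventually_gt_atTop 0).and
    ((ρ.tendsto_atTop_of_avgEnergy_lt hlt).eventually_gt_atTop 0)).exists
  simp only [← neg_sub _ t, sum_neg_distrib] at hpos'
  linarith

theorem le_avgEnergy_of_eventually_le (ρ : G.Play) {t : ℝ}
    (h : ∀ᶠ n in atTop, t ≤ ρ.energy n) : (t : EReal) ≤ ρ.avgEnergy := by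
  by_contra! hlt
  obtain ⟨m, hm⟩ := eventually_atTop.1 h
  have hanti : ∀ n, m ≤ n →
      ∑ i ∈ range n, (t - ρ.energy i) ≤ ∑ i ∈ range m, (t - ρ.energy i) := by
    intro n hn
    rw [← sum_range_add_sum_Ico _ hn]
    exact add_le_of_nonpos_right
      (sum_nonpos fun i hi => sub_nonpos.2 (hm i (mem_Ico.1 hi).1))
  obtain ⟨n, hgt, hmn⟩ := (((ρ.tendsto_atTop_of_avgEnergy_lt hlt).eventually_gt_atTop
    (∑ i ∈ range m, (t - ρ.energy i))).and (eventually_ge_atTop m)).exists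
  exact (hanti n hmn).not_gt hgt

theorem avgEnergy_eq_top_of_tendsto_atTop (ρ : G.Play) (h : Tendsto ρ.energy atTop atTop) :
    ρ.avgEnergy = ⊤ := by
  refine EReal.eq_top_iff_forall_lt _ |>.2 fun t => ?_
  refine (EReal.coe_lt_coe_iff.2 (lt_add_one t)).trans_le (ρ.le_avgEnergy_of_eventually_le ?_)
  exact (tendsto_intCast_atTop_atTop.comp h).eventually_ge_atTop (t + 1)

end Game.Play

theorem Game.abs_weight_le [Fintype S] {s s' : S} (h : G.edge s s') :
    |G.weight s s'| ≤ G.maxWeight := by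
  classical
  rw [Int.abs_eq_natAbs]
  unfold maxWeight
  exact_mod_cast le_sup (f := fun e : S × S => (G.weight e.1 e.2).natAbs) (b := (s, s'))
    (mem_filter.2 ⟨mem_univ _, h⟩)

theorem Game.outcome_spec (s₀ : S) (σ₁ : G.Strategy .one) (σ₂ : G.Strategy .two) :
    (outcome s₀ σ₁ σ₂).state 0 = s₀ ∧ (outcome s₀ σ₁ σ₂).Consistent σ₁ ∧
      (outcome s₀ σ₁ σ₂).Consistent σ₂ :=
  (existsUnique_outcome s₀ σ₁ σ₂).choose_spec.1

theorem Game.nonempty_strategy_of_states_eq_empty {i : Player} (h : G.states i = ∅) (s₀ : S) :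
    Nonempty (G.Strategy i) :=
  ⟨⟨fun _ => s₀, fun ρ n hn => absurd (show ρ.state n ∈ G.states i from hn) (by simp [h])⟩⟩

theorem Game.owner_eq_one (h : G.states .two = ∅) (s : S) : G.owner s = .one := by
  cases ho : G.owner s
  · rfl
  · exact absurd (show s ∈ G.states .two from ho) (by simp [h])

theorem Game.owner_eq_two (h : G.states .one = ∅) (s : S) : G.owner s = .two := by
  cases ho : G.owner s
  · exact absurd (show s ∈ G.states .one from ho) (by simp [h])
  · rfl

end AverageEnergy

section Machines

variable {S M : Type*} {G : Game S} {i : Player}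

open Game

/-- The memory state of a machine before the `n`-th move. -/
def MooreMachine.memory (A : MooreMachine S M) (x : ℕ → S) (n : ℕ) : M :=
  ((List.range n).map x).foldl A.update A.init

theorem MooreMachine.memory_succ (A : MooreMachine S M) (x : ℕ → S) (n : ℕ) :
    A.memory x (n + 1) = A.update (A.memory x n) (x n) := by
  simp [memory, List.range_succ]

instance [Finite S] [Finite M] : Finite (MooreMachine S M) :=
  Finite.of_injective (fun A => (A.init, A.update, A.next)) fun A B h => by
    cases A
    cases B
    simpa using h

namespace Game.Play

/-- Every move of the play is the one proposed by the machine. -/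
def Follows (ρ : G.Play) (A : MooreMachine S M) : Prop :=
  ∀ n, ρ.state (n + 1) = A.next (A.memory ρ.state n) (ρ.state n)

/-- The play follows some Moore machine with memory set `M`. -/
def IsGenerated (ρ : G.Play) (M : Type*) : Prop := ∃ A : MooreMachine S M, ρ.Follows A

theorem Follows.congr_add {ρ π : G.Play} {A : MooreMachine S M} (hρ : ρ.Follows A)
    (hπ : π.Follows A) {m n : ℕ} (hstate : ρ.state m = π.state n)
    (hmemory : A.memory ρ.state m = A.memory π.state n) (d : ℕ) :
    ρ.state (m + d) = π.state (n + d) ∧ A.memory ρ.state (m + d) = A.memory π.state (n + d) := by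
  induction d with
  | zero => exact ⟨hstate, hmemory⟩
  | succ d ih =>
    rw [← add_assoc, ← add_assoc, hρ, hπ, A.memory_succ, A.memory_succ, ih.1, ih.2]
    exact ⟨rfl, rfl⟩

theorem Follows.eq {ρ π : G.Play} {A : MooreMachine S M} (hρ : ρ.Follows A) (hπ : π.Follows A)
    (h0 : ρ.state 0 = π.state 0) : ρ = π :=
  eq_of_state_eq fun n => by simpa only [zero_add] using (hρ.congr_add hπ h0 rfl n).1

theorem IsGenerated.of_equiv {M' : Type*} (e : M ≃ M') {ρ : G.Play} (h : ρ.IsGenerated M) :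
    ρ.IsGenerated M' := by
  obtain ⟨A, hA⟩ := h
  let A' : MooreMachine S M' :=
    ⟨e A.init, fun m s => e (A.update (e.symm m) s), fun m s => A.next (e.symm m) s⟩
  have hmemory : ∀ n, e.symm (A'.memory ρ.state n) = A.memory ρ.state n := by
    intro n
    induction n with
    | zero => exact e.symm_apply_apply _
    | succ n ih => rw [A'.memory_succ, A.memory_succ, ← ih, e.symm_apply_apply]
  exact ⟨A', fun n => (hA n).trans (by rw [← hmemory])⟩

theorem isGenerated_of_iterate {ρ : G.Play} {f : M → M} {out : M → S} {m₀ : M}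
    (h : ∀ n, ρ.state n = out (f^[n] m₀)) : ρ.IsGenerated M := by
  let A : MooreMachine S M := ⟨m₀, fun m _ => f m, fun m _ => out (f m)⟩
  have hmemory : ∀ n, A.memory ρ.state n = f^[n] m₀ := by
    intro n
    induction n with
    | zero => rfl
    | succ n ih => rw [A.memory_succ, ih, Function.iterate_succ_apply']
  exact ⟨A, fun n => by rw [h, hmemory, Function.iterate_succ_apply']⟩

theorem isGenerated_nat (ρ : G.Play) : ρ.IsGenerated ℕ :=
  isGenerated_of_iterate (f := (· + 1)) (m₀ := 0) (out := ρ.state) fun n => by simp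

theorem isGenerated_unit {ρ : G.Play} {f : S → S} (h : ∀ n, ρ.state (n + 1) = f (ρ.state n)) :
    ρ.IsGenerated Unit :=
  ⟨⟨(), fun _ _ => (), fun _ => f⟩, h⟩

theorem finite_isGenerated [Finite S] [Finite M] (s₀ : S) :
    {ρ : G.Play | ρ.state 0 = s₀ ∧ ρ.IsGenerated M}.Finite := by
  have hunique : ∀ A : MooreMachine S M, {ρ : G.Play | ρ.state 0 = s₀ ∧ ρ.Follows A}.Subsingleton :=
    fun A ρ hρ π hπ => hρ.2.eq hπ.2 (hρ.1.trans hπ.1.symm)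
  refine (Set.finite_iUnion fun A => (hunique A).finite).subset ?_
  rintro ρ ⟨h0, A, hA⟩
  exact Set.mem_iUnion.2 ⟨A, h0, hA⟩

end Game.Play

theorem Game.exists_strategy_of_isGenerated (hown : ∀ s, G.owner s = i) {ρ : G.Play}
    (hρ : ρ.IsGenerated M) :
    ∃ σ : G.Strategy i, (∃ A : MooreMachine S M, σ.EncodedBy A) ∧
      ∀ π : G.Play, π.state 0 = ρ.state 0 → π.Consistent σ → π = ρ := by
  classical
  obtain ⟨A, hA⟩ := hρ
  choose succ hsucc using G.total
  -- off `ρ` the moves proposed by `A` need not be edges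
  let A' : MooreMachine S M :=
    ⟨A.init, A.update, fun m s => if G.edge s (A.next m s) then A.next m s else succ s⟩
  have hedge : ∀ m s, G.edge s (A'.next m s) := fun m s => by
    by_cases h : G.edge s (A.next m s) <;> simp [A', h, hsucc]
  have hfollows : ρ.Follows A' := fun n => (hA n).trans (if_pos (hA n ▸ ρ.step n)).symm
  let move (l : List S) : S :=
    A'.next (l.dropLast.foldl A'.update A'.init) (l.getLast?.getD (ρ.state 0))
  have hmove : ∀ (π : G.Play) n,
      move (π.pref n) = A'.next (A'.memory π.state n) (π.state n) := fun π n => by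
    simp [move, Play.pref, List.range_succ, MooreMachine.memory]
  refine ⟨⟨move, fun π n _ => hmove π n ▸ hedge _ _⟩, ⟨A', fun π n _ => hmove π n⟩,
    fun π h0 hπ => Play.Follows.eq (fun n => ?_) hfollows h0⟩
  exact (hπ n (hown _)).symm.trans (hmove π n)

theorem Game.Play.Consistent.follows {σ : G.Strategy i} {A : MooreMachine S M} {ρ : G.Play}
    (hρ : ρ.Consistent σ) (hσ : σ.EncodedBy A) (hown : ∀ s, G.owner s = i) : ρ.Follows A :=
  fun n => (hρ n (hown _)).symm.trans (hσ ρ n (hown _))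

theorem Game.exists_winsOne_of_isGenerated (h2 : G.states .two = ∅) {Obj : Set G.Play} {ρ : G.Play}
    (hρ : ρ ∈ Obj) (hgen : ρ.IsGenerated M) :
    ∃ σ : G.Strategy .one, WinsOne (ρ.state 0) Obj σ ∧ ∃ A : MooreMachine S M, σ.EncodedBy A := by
  obtain ⟨σ, hA, huniq⟩ := exists_strategy_of_isGenerated (owner_eq_one h2) hgen
  refine ⟨σ, fun σ₂ => ?_, hA⟩
  obtain ⟨h0, hσ, -⟩ := outcome_spec (ρ.state 0) σ σ₂
  rwa [huniq _ h0 hσ]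

theorem Game.exists_winsTwo_of_isGenerated (h1 : G.states .one = ∅) {Obj : Set G.Play} {ρ : G.Play}
    (hρ : ρ ∉ Obj) (hgen : ρ.IsGenerated M) :
    ∃ σ : G.Strategy .two, WinsTwo (ρ.state 0) Obj σ ∧ ∃ A : MooreMachine S M, σ.EncodedBy A := by
  obtain ⟨σ, hA, huniq⟩ := exists_strategy_of_isGenerated (owner_eq_two h1) hgen
  refine ⟨σ, fun σ₁ => ?_, hA⟩
  obtain ⟨h0, -, hσ⟩ := outcome_spec (ρ.state 0) σ₁ σ
  rwa [huniq _ h0 hσ]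

theorem Game.Strategy.encodedBy_of_states_eq_empty (h : G.states i = ∅) (σ : G.Strategy i)
    (A : MooreMachine S M) : σ.EncodedBy A :=
  fun ρ n hn => absurd (show ρ.state n ∈ G.states i from hn) (by simp [h])

theorem Game.Strategy.EncodedBy.memoryless {σ : G.Strategy i} {A : MooreMachine S Unit}
    (h : σ.EncodedBy A) : σ.Memoryless :=
  ⟨A.next (), h⟩

end Machines

section Excursions

/-- `u` and `d` are the last position before `m` and the first position after `m` at which `e` is
at most `l`. -/
structure IsExcursion (e : ℕ → ℕ) (l m u d : ℕ) : Prop where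
  left_lt : u < m
  lt_right : m < d
  left_le : e u ≤ l
  right_le : e d ≤ l
  lt_of_between : ∀ i, u < i → i < d → l < e i

theorem exists_isExcursion {e : ℕ → ℕ} {l m k : ℕ} (h0 : e 0 ≤ l) (hm : l < e m) (hmk : m ≤ k)
    (hk : e k ≤ l) : ∃ u d, IsExcursion e l m u d ∧ d ≤ k := by
  classical
  have hex : ∃ d, m ≤ d ∧ e d ≤ l := ⟨k, hmk, hk⟩
  have hleft : e (Nat.findGreatest (fun i => e i ≤ l) m) ≤ l :=
    Nat.findGreatest_spec (P := fun i => e i ≤ l) m.zero_le h0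
  obtain ⟨hle, hright⟩ := Nat.find_spec hex
  refine ⟨Nat.findGreatest (fun i => e i ≤ l) m, Nat.find hex,
    ⟨(Nat.findGreatest_le m).lt_of_ne ?_, hle.lt_of_ne ?_, hleft, hright, fun i hu hd => ?_⟩,
    Nat.find_min' hex ⟨hmk, hk⟩⟩
  · intro heq
    exact hm.not_ge (heq ▸ hleft)
  · intro heq
    exact hm.not_ge (heq ▸ hright)
  · by_contra! hi
    rcases le_or_gt i m with him | hmi
    · exact Nat.findGreatest_is_greatest hu him hi
    · exact Nat.find_min hex hd ⟨hmi.le, hi⟩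

namespace IsExcursion

variable {e : ℕ → ℕ} {l l' m u d u' d' : ℕ}

theorem left_le_left (h : IsExcursion e l m u d) (h' : IsExcursion e l' m u' d') (hl : l ≤ l') :
    u ≤ u' := by
  by_contra! hlt
  have := h'.lt_of_between u hlt (h.left_lt.trans h'.lt_right)
  have := h.left_le
  lia

theorem right_le_right (h : IsExcursion e l m u d) (h' : IsExcursion e l' m u' d') (hl : l ≤ l') :
    d' ≤ d := by
  by_contra! hlt
  have := h'.lt_of_between d (h'.left_lt.trans h.lt_right) hlt
  have := h.right_le
  lia

theorem le_left_add {W : ℕ} (h : IsExcursion e l m u d) (hstep : e (u + 1) ≤ e u + W) :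
    l ≤ e u + W := by
  have hlt : u + 1 < d := (Nat.succ_le_of_lt h.left_lt).trans_lt h.lt_right
  exact (h.lt_of_between (u + 1) u.lt_succ_self hlt).le.trans hstep

theorem le_right_add {W : ℕ} (h : IsExcursion e l m u d) (hstep : e (d - 1) ≤ e (d - 1 + 1) + W) :
    l ≤ e d + W := by
  have := h.left_lt
  have := h.lt_right
  rw [Nat.sub_add_cancel (by lia)] at hstep
  exact (h.lt_of_between (d - 1) (by lia) (by lia)).le.trans hstep

theorem le_apply {a i : ℕ} (h : IsExcursion e l m u d) (hl : a ≤ l) (hu : a ≤ e u) (hd : a ≤ e d)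
    (hui : u ≤ i) (hid : i ≤ d) : a ≤ e i := by
  rcases hui.eq_or_lt with rfl | hui
  · exact hu
  rcases hid.eq_or_lt with rfl | hid
  · exact hd
  exact hl.trans (h.lt_of_between i hui hid).le

end IsExcursion

-- The records `(s₁ l, l - e₁ l, s₂ l, l - e₂ l)` take fewer values than there are levels `l`.
theorem exists_congruent_levels {S : Type*} [Fintype S] {a W : ℕ} {s₁ s₂ : ℕ → S} {e₁ e₂ : ℕ → ℕ}
    (h₁ : ∀ l ∈ Icc a (a + Fintype.card S ^ 2 * (W + 1) ^ 2), e₁ l ≤ l ∧ l ≤ e₁ l + W)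
    (h₂ : ∀ l ∈ Icc a (a + Fintype.card S ^ 2 * (W + 1) ^ 2), e₂ l ≤ l ∧ l ≤ e₂ l + W) :
    ∃ l h, a ≤ l ∧ 0 < h ∧ l + h ≤ a + Fintype.card S ^ 2 * (W + 1) ^ 2 ∧
      s₁ (l + h) = s₁ l ∧ e₁ (l + h) = e₁ l + h ∧ s₂ (l + h) = s₂ l ∧ e₂ (l + h) = e₂ l + h := by
  classical
  let record l := ((s₁ l, l - e₁ l), (s₂ l, l - e₂ l))
  let records : Finset ((S × ℕ) × (S × ℕ)) := (univ ×ˢ range (W + 1)) ×ˢ (univ ×ˢ range (W + 1))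
  have hmaps : ∀ l ∈ Icc a (a + Fintype.card S ^ 2 * (W + 1) ^ 2), record l ∈ records := by
    intro l hl
    have := h₁ l hl
    have := h₂ l hl
    simp only [record, records, mem_product, mem_univ, mem_range, true_and]
    lia
  have hcard : #records < #(Icc a (a + Fintype.card S ^ 2 * (W + 1) ^ 2)) := by
    simp only [records, card_product, card_univ, card_range, Nat.card_Icc]
    ring_nf
    lia
  obtain ⟨l, hl, l', hl', hlt, hrecord⟩ : ∃ l ∈ Icc a (a + Fintype.card S ^ 2 * (W + 1) ^ 2),
      ∃ l' ∈ Icc a (a + Fintype.card S ^ 2 * (W + 1) ^ 2), l < l' ∧ record l' = record l := by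
    obtain ⟨l, hl, l', hl', hne, heq⟩ := exists_ne_map_eq_of_card_lt_of_maps_to hcard hmaps
    rcases hne.lt_or_gt with hlt | hlt
    · exact ⟨l, hl, l', hl', hlt, heq.symm⟩
    · exact ⟨l', hl', l, hl, hlt, heq⟩
  obtain ⟨h, rfl⟩ := Nat.exists_eq_add_of_le hlt.le
  have := h₁ l hl
  have := h₁ _ hl'
  have := h₂ l hl
  have := h₂ _ hl'
  simp only [record, Prod.mk.injEq] at hrecord
  rw [mem_Icc] at hl hl'
  exact ⟨l, h, hl.1, by lia, hl'.2, hrecord.1.1, by lia, hrecord.2.1, by lia⟩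

theorem exists_congruent_excursions {S : Type*} [Fintype S] {s : ℕ → S} {e : ℕ → ℕ}
    {L W k m : ℕ} (hup : ∀ i < k, e (i + 1) ≤ e i + W) (hdown : ∀ i < k, e i ≤ e (i + 1) + W)
    (h0 : e 0 ≤ L) (hk : e k ≤ L) (hmk : m ≤ k)
    (hm : L + W + Fintype.card S ^ 2 * (W + 1) ^ 2 < e m) :
    ∃ l h u d u' d', L + W ≤ l ∧ 0 < h ∧ d ≤ k ∧ IsExcursion e l m u d ∧
      IsExcursion e (l + h) m u' d' ∧ s u' = s u ∧ s d' = s d ∧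
      e u' = e u + h ∧ e d' = e d + h := by
  have hex : ∀ l ∈ Icc (L + W) (L + W + Fintype.card S ^ 2 * (W + 1) ^ 2),
      ∃ u d, IsExcursion e l m u d ∧ d ≤ k := by
    intro l hl
    rw [mem_Icc] at hl
    exact exists_isExcursion (by lia) (by lia) hmk (by lia)
  choose! u d hexc hdk using hex
  obtain ⟨l, h, hl, hpos, hle, hsu, heu, hsd, hed⟩ := exists_congruent_levels (W := W)
    (s₁ := fun l => s (u l)) (e₁ := fun l => e (u l))
    (s₂ := fun l => s (d l)) (e₂ := fun l => e (d l))
    (fun l hl => by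
      have hlt := ((hexc l hl).left_lt.trans (hexc l hl).lt_right).trans_le (hdk l hl)
      exact ⟨(hexc l hl).left_le, (hexc l hl).le_left_add (hup _ hlt)⟩)
    (fun l hl => by
      have hlast : d l - 1 < k :=
        (Nat.sub_one_lt_of_lt (hexc l hl).lt_right).trans_le (hdk l hl)
      exact ⟨(hexc l hl).right_le, (hexc l hl).le_right_add (hdown _ hlast)⟩)
  exact ⟨l, h, u l, d l, u (l + h), d (l + h), hl, hpos, hdk l (mem_Icc.2 ⟨hl, by lia⟩),
    hexc l (mem_Icc.2 ⟨hl, by lia⟩), hexc (l + h) (mem_Icc.2 ⟨by lia, hle⟩), hsu, hsd, heu, hed⟩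

end Excursions

section Configurations

variable {S : Type*} {G : Game S}

open Game

/-- One move in the graph of configurations, which are pairs of a state and a nonnegative energy
level. -/
def Game.ConfigStep (G : Game S) (c c' : S × ℕ) : Prop :=
  G.edge c.1 c'.1 ∧ (c'.2 : ℤ) = c.2 + G.weight c.1 c'.1

/-- One move in the graph of configurations of energy at most `B`. -/
def Game.BoundedStep (G : Game S) (B : ℕ) (c c' : S × Fin (B + 1)) : Prop :=
  G.ConfigStep (c.1, c.2) (c'.1, c'.2)

namespace Game.ConfigStep

variable {c c' : S × ℕ}

theorem sub (hstep : G.ConfigStep c c') {h : ℕ} (hc : h ≤ c.2) (hc' : h ≤ c'.2) :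
    G.ConfigStep (c.1, c.2 - h) (c'.1, c'.2 - h) := by
  refine ⟨hstep.1, ?_⟩
  have := hstep.2
  push_cast [hc, hc']
  lia

theorem le_add_maxWeight [Fintype S] (hstep : G.ConfigStep c c') :
    c'.2 ≤ c.2 + G.maxWeight ∧ c.2 ≤ c'.2 + G.maxWeight := by
  have := abs_le.1 (abs_weight_le hstep.1)
  have := hstep.2
  lia

end Game.ConfigStep

theorem Game.exists_play_of_configStep {c : ℕ → S × ℕ} (h0 : (c 0).2 = 0)
    (hc : ∀ n, G.ConfigStep (c n) (c (n + 1))) :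
    ∃ π : G.Play, ∀ n, π.state n = (c n).1 ∧ π.energy n = (c n).2 := by
  let π : G.Play := ⟨fun n => (c n).1, fun n => (hc n).1⟩
  refine ⟨π, fun n => ⟨rfl, ?_⟩⟩
  induction n with
  | zero => rw [π.energy_zero, h0, Nat.cast_zero]
  | succ n ih => rw [π.energy_succ, ih, (hc n).2]

end Configurations

section BoundedEnergy

variable {S : Type*} [Fintype S] {G : Game S}

open Game

-- Between two congruent excursions of heights `l` and `l + h`, cut out the ascent from the lower to
-- the higher one and the matching descent, and lower what lies between them by `h`. The parts cut
-- out have energy at least `L ≥ τ`, so the gap to `τ` accumulated along the walk does not shrink.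
theorem exists_shorter_configWalk {r : ℕ → S × ℕ} {L k m : ℕ} {τ : ℝ} (hτ : τ ≤ L)
    (hr : ∀ i < k, G.ConfigStep (r i) (r (i + 1))) (h0 : (r 0).2 ≤ L) (hk : (r k).2 ≤ L)
    (hmk : m ≤ k)
    (hm : L + G.maxWeight + Fintype.card S ^ 2 * (G.maxWeight + 1) ^ 2 < (r m).2) :
    ∃ k' < k, ∃ x, ∑ i ∈ range k, (τ - ((r i).2 : ℝ)) ≤ x ∧
      HasWalk G.ConfigStep (fun c _ => τ - (c.2 : ℝ)) (r 0) (r k) k' x := by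
  obtain ⟨l, h, u, d, u', d', hl, hpos, hdk, hlow, hhigh, hu, hd, heu, hed⟩ :=
    exists_congruent_excursions (s := fun i => (r i).1) (e := fun i => (r i).2)
      (fun i hi => (hr i hi).le_add_maxWeight.1) (fun i hi => (hr i hi).le_add_maxWeight.2)
      h0 hk hmk hm
  have hum := hhigh.left_lt
  have hmd := hhigh.lt_right
  have huu' : u < u' := (hlow.left_le_left hhigh (by lia)).lt_of_ne (by rintro rfl; lia)
  have hdd' : d' ≤ d := hlow.right_le_right hhigh (by lia)
  have hLu := hlow.le_left_add (hr u (by lia)).le_add_maxWeight.1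
  have hLd := hlow.le_right_add (hr (d - 1) (by lia)).le_add_maxWeight.2
  have cut_nonpos : ∀ {i j}, u ≤ i → j ≤ d → ∑ n ∈ Ico i j, (τ - ((r n).2 : ℝ)) ≤ 0 := by
    intro i j hi hj
    refine sum_nonpos fun n hn => sub_nonpos.2 (hτ.trans ?_)
    rw [mem_Ico] at hn
    exact_mod_cast hlow.le_apply (a := L) (by lia) (by lia) (by lia) (hi.trans hn.1)
      (hn.2.le.trans hj)
  have hhr : ∀ i, u' ≤ i → i ≤ d' → h ≤ (r i).2 := fun i =>
    hhigh.le_apply (by lia) (by lia) (by lia)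
  have stem := HasWalk.of_segment (fun c _ => τ - (c.2 : ℝ)) r u.zero_le
    fun i _ hi => hr i (by lia)
  have lowered : HasWalk G.ConfigStep (fun c _ => τ - (c.2 : ℝ)) (r u) (r d) (d' - u')
      (∑ i ∈ Ico u' d', (τ - (((r i).2 - h : ℕ) : ℝ))) := by
    rw [show r u = ((r u').1, (r u').2 - h) from Prod.ext hu.symm (by lia),
      show r d = ((r d').1, (r d').2 - h) from Prod.ext hd.symm (by lia)]
    exact .of_segment _ (fun i => ((r i).1, (r i).2 - h) : ℕ → S × ℕ)
      (hum.trans hmd).le fun i hi hi' =>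
        (hr i (by lia)).sub (hhr i hi hi'.le) (hhr (i + 1) (by lia) hi')
  have tail := HasWalk.of_segment (fun c _ => τ - (c.2 : ℝ)) r hdk fun i _ hi => hr i hi
  refine ⟨_, ?_, _, ?_, (stem.trans lowered).trans tail⟩
  · lia
  · have hlowered : ∑ i ∈ Ico u' d', (τ - ((r i).2 : ℝ)) ≤
        ∑ i ∈ Ico u' d', (τ - (((r i).2 - h : ℕ) : ℝ)) := by
      gcongr
      lia
    rw [range_eq_Ico, ← sum_Ico_consecutive _ u.zero_le (by lia : u ≤ k),
      ← sum_Ico_consecutive _ (by lia : u ≤ d) hdk,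
      ← sum_Ico_consecutive _ huu'.le (by lia : u' ≤ d),
      ← sum_Ico_consecutive _ (hum.trans hmd).le hdd']
    linarith [cut_nonpos le_rfl (show u' ≤ d by lia), cut_nonpos (show u ≤ d' by lia) le_rfl]

theorem exists_boundedWalk {L B k : ℕ} {τ x : ℝ} (hτ : τ ≤ L)
    (hB : L + G.maxWeight + Fintype.card S ^ 2 * (G.maxWeight + 1) ^ 2 ≤ B)
    {a b : S × Fin (B + 1)} (ha : (a.2 : ℕ) ≤ L) (hb : (b.2 : ℕ) ≤ L)
    (h : HasWalk G.ConfigStep (fun c _ => τ - (c.2 : ℝ)) (a.1, a.2) (b.1, b.2) k x) :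
    ∃ k' x', x ≤ x' ∧ HasWalk (G.BoundedStep B) (fun c _ => τ - (c.2 : ℝ)) a b k' x' := by
  induction k using Nat.strong_induction_on generalizing x with
  | _ k ih =>
    obtain ⟨r, h0, hk, hr, rfl⟩ := h
    by_cases hlow : ∀ m ≤ k, (r m).2 ≤ B
    · let clamp (c : S × ℕ) : S × Fin (B + 1) := (c.1, Fin.ofNat (B + 1) c.2)
      have hval : ∀ m ≤ k, ((clamp (r m)).2 : ℕ) = (r m).2 := fun m hm =>
        Nat.mod_eq_of_lt (Nat.lt_succ_of_le (hlow m hm))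
      refine ⟨k, _, le_rfl, fun i => clamp (r i), ?_, ?_, fun i hi => ?_, ?_⟩
      · simp [clamp, h0]
      · simp [clamp, hk]
      · unfold BoundedStep
        rw [hval i hi.le, hval (i + 1) hi]
        exact hr i hi
      · exact sum_congr rfl fun i hi => by
          simp only [hval i (mem_range.1 hi).le]
    · push Not at hlow
      obtain ⟨m, hmk, hm⟩ := hlow
      obtain ⟨k', hk', x', hx', hwalk⟩ := exists_shorter_configWalk hτ hr
        (by rwa [h0]) (by rwa [hk]) hmk (hB.trans_lt hm)
      rw [h0, hk] at hwalk
      obtain ⟨k'', x'', hx'', h''⟩ := ih k' hk' hwalk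
      exact ⟨k'', x'', hx'.trans hx'', h''⟩

theorem exists_boundedLasso {L B : ℕ} {τ : ℝ} (hτ : τ ≤ L)
    (hB : L + G.maxWeight + Fintype.card S ^ 2 * (G.maxWeight + 1) ^ 2 ≤ B) {ρ : G.Play}
    (hρ : ρ ∈ G.lowerBounded 0) (havg : ρ.avgEnergy < (τ : EReal)) :
    ∃ n, HasPositiveLasso (G.BoundedStep B) (fun c _ => τ - (c.2 : ℝ)) (ρ.state 0, 0) n := by
  have hnonneg : ∀ n, ((ρ.energy n).toNat : ℤ) = ρ.energy n := fun n =>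
    Int.toNat_of_nonneg (by simpa using hρ n)
  have hnonneg' : ∀ n, ((ρ.energy n).toNat : ℝ) = ρ.energy n := fun n => by
    exact_mod_cast congrArg (Int.cast : ℤ → ℝ) (hnonneg n)
  let x : ℕ → S × ℕ := fun n => (ρ.state n, (ρ.energy n).toNat)
  have hx : ∀ n, G.ConfigStep (x n) (x (n + 1)) := fun n =>
    ⟨ρ.step n, (hnonneg (n + 1)).trans (by rw [ρ.energy_succ, hnonneg])⟩
  have hfin : (Set.range x ∩ {c | 0 < τ - (c.2 : ℝ)}).Finite := by
    refine ((Set.finite_univ (α := S)).prod (Set.finite_Iic L)).subset ?_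
    rintro c ⟨-, hc⟩
    exact ⟨trivial, by exact_mod_cast (sub_pos.1 hc).le.trans hτ⟩
  have hunbdd : ¬ BddAbove (Set.range fun n => ∑ i ∈ range n, (τ - ((x i).2 : ℝ))) := by
    simp only [x, hnonneg']
    exact not_bddAbove_of_tendsto_atTop (ρ.tendsto_atTop_of_avgEnergy_lt havg)
  obtain ⟨i, j, hij, heq, hi, hsum⟩ := exists_return_of_not_bddAbove x
      (fun c => τ - (c.2 : ℝ)) hfin hunbdd
  have hle : (x i).2 ≤ L := by exact_mod_cast (sub_pos.1 hi).le.trans hτ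
  let b : S × Fin (B + 1) := (ρ.state i, ⟨(x i).2, by lia⟩)
  have stem := HasWalk.of_segment (fun c _ => τ - (c.2 : ℝ)) x i.zero_le fun n _ _ => hx n
  have cycle := HasWalk.of_segment (fun c _ => τ - (c.2 : ℝ)) x hij.le fun n _ _ => hx n
  rw [← heq] at cycle
  rw [show x 0 = (ρ.state 0, 0) by simp [x, ρ.energy_zero]] at stem
  obtain ⟨p, y, -, hstem⟩ := exists_boundedWalk (a := (ρ.state 0, 0)) (b := b) hτ hB
    (Nat.zero_le _) hle stem
  obtain ⟨q, z, hz, hcycle⟩ := exists_boundedWalk (a := b) (b := b) hτ hB hle hle cycle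
  exact ⟨_, b, p, q, y, z, hstem, hcycle, hsum.trans_le hz, rfl⟩

theorem exists_boundedPlay {L B : ℕ} {τ : ℝ} (hτ : τ ≤ L)
    (hB : L + G.maxWeight + Fintype.card S ^ 2 * (G.maxWeight + 1) ^ 2 ≤ B) {ρ : G.Play}
    (hρ : ρ ∈ G.lowerBounded 0) (havg : ρ.avgEnergy < (τ : EReal)) :
    ∃ π : G.Play, π.state 0 = ρ.state 0 ∧ π.IsGenerated (S × Fin (B + 1)) ∧
      π ∈ G.lowerBounded 0 ∧ π.avgEnergy ≤ (τ : EReal) := by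
  obtain ⟨n, hlasso⟩ := exists_boundedLasso hτ hB hρ havg
  obtain ⟨f, hstep, htendsto⟩ := hlasso.exists_iterate_tendsto_atTop
  obtain ⟨π, hπ⟩ := Game.exists_play_of_configStep (G := G)
    (c := fun n => ((f^[n] (ρ.state 0, 0)).1, (f^[n] (ρ.state 0, 0)).2)) rfl hstep
  refine ⟨π, (hπ 0).1, Play.isGenerated_of_iterate (out := Prod.fst) fun n => (hπ n).1, fun n => ?_,
    π.avgEnergy_le_of_tendsto_atTop ?_⟩
  · simp [(hπ n).2]
  · simpa only [(hπ _).2, Int.cast_natCast] using htendsto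

-- Only finitely many plays are generated by a machine of the given size, so the infimum over
-- thresholds `τ > t` is attained.
theorem exists_boundedPlay_mem_AEL {t : ℚ} {B : ℕ}
    (hB : ⌈t⌉₊ + 1 + G.maxWeight + Fintype.card S ^ 2 * (G.maxWeight + 1) ^ 2 ≤ B) {ρ : G.Play}
    (hρ : ρ ∈ G.AEL t) :
    ∃ π ∈ G.AEL t, π.state 0 = ρ.state 0 ∧ π.IsGenerated (S × Fin (B + 1)) := by
  let P : Set G.Play := {π | (π.state 0 = ρ.state 0 ∧ π.IsGenerated (S × Fin (B + 1))) ∧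
    π ∈ G.lowerBounded 0}
  have hlt : (t : ℝ) < (⌈t⌉₊ + 1 : ℕ) := by
    exact_mod_cast (Nat.le_ceil t).trans_lt (lt_add_one _)
  have happrox : ∀ τ : ℝ, (t : ℝ) < τ → τ ≤ (⌈t⌉₊ + 1 : ℕ) →
      ∃ π ∈ P, π.avgEnergy ≤ (τ : EReal) := by
    intro τ htτ hτ
    obtain ⟨π, h0, hgen, hnonneg, havg⟩ := exists_boundedPlay hτ hB hρ.1
      (hρ.2.trans_lt (EReal.coe_lt_coe_iff.2 htτ))
    exact ⟨π, ⟨⟨h0, hgen⟩, hnonneg⟩, havg⟩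
  obtain ⟨π₀, hπ₀, -⟩ := happrox _ hlt le_rfl
  have hfin : P.Finite := (Play.finite_isGenerated (ρ.state 0)).subset fun π hπ => hπ.1
  obtain ⟨π, hπ, hmin⟩ := Set.exists_min_image P Play.avgEnergy hfin ⟨π₀, hπ₀⟩
  suffices havg : π.avgEnergy ≤ ((t : ℝ) : EReal) from ⟨π, ⟨hπ.2, havg⟩, hπ.1⟩
  refine le_of_forall_gt_imp_ge_of_dense fun a ha => ?_
  obtain ⟨τ, htτ, hτa⟩ := EReal.lt_iff_exists_real_btwn.1 ha
  obtain ⟨π', hπ', havg⟩ := happrox (min τ (⌈t⌉₊ + 1 : ℕ))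
    (lt_min (EReal.coe_lt_coe_iff.1 htτ) hlt) (min_le_right _ _)
  exact (hmin π' hπ').trans (havg.trans
    ((EReal.coe_le_coe_iff.2 (min_le_left _ _)).trans hτa.le))

theorem exists_winsOne_hasMemory (h2 : G.states .two = ∅) {t : ℚ} {ρ : G.Play}
    (hρ : ρ ∈ G.AEL t) :
    ∃ σ : G.Strategy .one, WinsOne (ρ.state 0) (G.AEL t) σ ∧
      σ.HasMemory (Fintype.card S * (⌈t⌉₊ + 1 + G.maxWeight +
        Fintype.card S ^ 2 * (G.maxWeight + 1) ^ 2 + 1)) := by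
  obtain ⟨π, hπ, h0, hgen⟩ := exists_boundedPlay_mem_AEL le_rfl hρ
  rw [← h0]
  exact exists_winsOne_of_isGenerated h2 hπ
    (hgen.of_equiv ((Fintype.equivFin S).prodCongr (.refl _) |>.trans finProdFinEquiv))

end BoundedEnergy

section CounterGame

open Game

/-- The game of player 1 with states `0` and `1` in which the cycle through both gains `1` and the
loop at `0` loses `U`. -/
def counterGame (U : ℕ) : Game (Fin 2) where
  owner _ := .one
  edge s s' := s = 0 ∨ s' = 0
  weight s s' := if s = 0 then (if s' = 0 then -U else 1) else 0
  total _ := ⟨0, Or.inr rfl⟩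

variable {U : ℕ}

theorem counterGame_states_two (U : ℕ) : (counterGame U).states .two = ∅ := by
  simp [states, counterGame]

theorem counterGame_maxWeight (hU : 1 ≤ U) : (counterGame U).maxWeight = U := by
  classical
  refine le_antisymm (Finset.sup_le fun e _ => ?_) ?_
  · simp only [counterGame]
    split_ifs <;> simp [hU]
  · have := abs_weight_le (G := counterGame U) (s := 0) (s' := 0) (Or.inl rfl)
    simpa [counterGame] using this

theorem mod_two_mul_add_one_succ (U n : ℕ) :
    n % (2 * U + 1) < 2 * U ∧ (n + 1) % (2 * U + 1) = n % (2 * U + 1) + 1 ∨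
      n % (2 * U + 1) = 2 * U ∧ (n + 1) % (2 * U + 1) = 0 := by
  have hlt := n.mod_lt (2 * U).succ_pos
  rw [← Nat.mod_add_mod]
  rcases (Nat.le_of_lt_succ hlt).lt_or_eq with h | h
  · exact .inl ⟨h, Nat.mod_eq_of_lt (Nat.succ_lt_succ h)⟩
  · exact .inr ⟨h, by rw [h, Nat.mod_self]⟩

/-- The play of the counter game that repeats `U` turns of the cycle followed by the loop. -/
def counterPlay (U : ℕ) : (counterGame U).Play where
  state n := if n % (2 * U + 1) % 2 = 0 then 0 else 1
  step n := by
    rcases mod_two_mul_add_one_succ U n with h | h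
    · rcases Nat.mod_two_eq_zero_or_one (n % (2 * U + 1)) with hi | hi
      · exact .inl (if_pos hi)
      · exact .inr (if_pos (by lia))
    · exact .inl (if_pos (by lia))

theorem counterPlay_energy (U n : ℕ) :
    (counterPlay U).energy n = ((n % (2 * U + 1) + 1) / 2 : ℕ) := by
  induction n with
  | zero => simp [Play.energy_zero]
  | succ n ih =>
    rw [Play.energy_succ, ih]
    simp only [counterGame, counterPlay]
    grind [mod_two_mul_add_one_succ U n]

theorem sum_range_half (U : ℕ) : ∑ i ∈ range (2 * U + 1), (i + 1) / 2 = U * (U + 1) := by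
  induction U with
  | zero => simp
  | succ U ih =>
    rw [show 2 * (U + 1) + 1 = 2 * U + 1 + 1 + 1 by ring, sum_range_succ, sum_range_succ, ih,
      show (2 * U + 1 + 1) / 2 = U + 1 by lia, show (2 * U + 1 + 1 + 1) / 2 = U + 1 by lia]
    ring

theorem counterPlay_mem_AEL (U : ℕ) :
    counterPlay U ∈ (counterGame U).AEL ((U * (U + 1) : ℚ) / (2 * U + 1)) := by
  refine ⟨fun n => by simp only [counterPlay_energy]; positivity, Play.avgEnergy_le_of_bddAbove _
    (bddAbove_range_sum_range_of_periodic (q := 2 * U + 1) (fun n => ?_) (by lia) ?_)⟩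
  · simp only [counterPlay_energy, Nat.add_mod_right]
  · have hsum : ∑ n ∈ range (2 * U + 1), ((counterPlay U).energy n : ℝ) = U * (U + 1) := by
      rw [← Nat.cast_add_one, ← Nat.cast_mul, ← sum_range_half, Nat.cast_sum]
      refine sum_congr rfl fun n hn => ?_
      rw [counterPlay_energy, Nat.mod_eq_of_lt (mem_range.1 hn), Int.cast_natCast]
    rw [sum_sub_distrib, hsum, sum_const, card_range, nsmul_eq_mul]
    push_cast
    field_simp
    ring

theorem counterGame_exists_winsOne (U : ℕ) : ∃ σ : (counterGame U).Strategy .one,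
    WinsOne 0 ((counterGame U).AEL ((U * (U + 1) : ℚ) / (2 * U + 1))) σ := by
  obtain ⟨σ, hσ, -⟩ := exists_winsOne_of_isGenerated (counterGame_states_two U)
    (counterPlay_mem_AEL U) (counterPlay U).isGenerated_nat
  exact ⟨σ, hσ⟩

theorem counterGame_state_energy_two_mul {ρ : (counterGame U).Play} (h0 : ρ.state 0 = 0) {N : ℕ}
    (hN : ∀ j < N, ρ.state (2 * j + 1) ≠ 0) : ρ.state (2 * N) = 0 ∧ ρ.energy (2 * N) = N := by
  induction N with
  | zero => exact ⟨h0, by simp [ρ.energy_zero]⟩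
  | succ N ih =>
    obtain ⟨hstate, henergy⟩ := ih fun j hj => hN j (by lia)
    have hodd := hN N N.lt_succ_self
    have heven : ρ.state (2 * N + 1 + 1) = 0 := (ρ.step (2 * N + 1)).resolve_left hodd
    refine ⟨heven, ?_⟩
    rw [show 2 * (N + 1) = 2 * N + 1 + 1 by ring, ρ.energy_succ, ρ.energy_succ, henergy]
    simp [counterGame, hstate, hodd]

theorem counterGame_exists_state_odd_eq_zero {ρ : (counterGame U).Play} (h0 : ρ.state 0 = 0)
    (havg : ρ.avgEnergy ≠ ⊤) : ∃ N, ρ.state (2 * N + 1) = 0 := by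
  contrapose! havg
  refine ρ.avgEnergy_eq_top_of_tendsto_atTop (tendsto_atTop_mono (f := fun n => ((n / 2 : ℕ) : ℤ))
    (fun n => ?_) (tendsto_natCast_atTop_atTop.comp (Nat.tendsto_div_const_atTop two_ne_zero)))
  obtain ⟨hstate, henergy⟩ :=
    counterGame_state_energy_two_mul h0 (N := n / 2) fun j _ => havg j
  rcases n.even_or_odd' with ⟨m, rfl | rfl⟩
  · rw [Nat.mul_div_cancel_left m two_pos] at henergy ⊢
    exact henergy.ge
  · rw [show (2 * m + 1) / 2 = m by lia] at hstate henergy ⊢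
    rw [ρ.energy_succ, henergy]
    simp [counterGame, hstate, havg m]

-- Let `2 N` be the first even time at which the loop is taken. It costs `U`, so `U ≤ N`, and up to
-- then the machine must count the turns of the cycle.
theorem counterGame_le_card_memory {ρ : (counterGame U).Play} {t : ℚ}
    (hρ : ρ ∈ (counterGame U).AEL t) (h0 : ρ.state 0 = 0) {k : ℕ}
    {A : MooreMachine (Fin 2) (Fin k)} (hA : ρ.Follows A) : U + 1 ≤ k := by
  classical
  have hex := counterGame_exists_state_odd_eq_zero h0 (hρ.2.trans_lt (EReal.coe_lt_top _)).ne
  obtain ⟨N, hN, hmin⟩ : ∃ N, ρ.state (2 * N + 1) = 0 ∧ ∀ j < N, ρ.state (2 * j + 1) ≠ 0 :=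
    ⟨Nat.find hex, Nat.find_spec hex, fun _ => Nat.find_min hex⟩
  have heven : ∀ j ≤ N, ρ.state (2 * j) = 0 := fun j hj =>
    (counterGame_state_energy_two_mul h0 fun i hi => hmin i (hi.trans_le hj)).1
  have hUN : U ≤ N := by
    have hnonneg := hρ.1 (2 * N + 1)
    rw [ρ.energy_succ, (counterGame_state_energy_two_mul h0 hmin).2] at hnonneg
    simpa [counterGame, heven N le_rfl, hN] using hnonneg
  have hinj : Function.Injective fun j : Fin (N + 1) => A.memory ρ.state (2 * j) := by
    refine .of_lt_imp_ne fun i j hij hmemory => ?_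
    have hi : (i : ℕ) ≤ N := Fin.is_le i
    have hj : (j : ℕ) ≤ N := Fin.is_le j
    have : (i : ℕ) < j := hij
    have hshift := (hA.congr_add hA ((heven i hi).trans (heven j hj).symm) hmemory
      (2 * (N - j) + 1)).1
    rw [show 2 * (j : ℕ) + (2 * (N - j) + 1) = 2 * N + 1 by lia, hN,
      show 2 * (i : ℕ) + (2 * (N - j) + 1) = 2 * (i + (N - j)) + 1 by lia] at hshift
    exact hmin _ (by lia) hshift
  have hcard := Fintype.card_le_of_injective _ hinj
  rw [Fintype.card_fin, Fintype.card_fin] at hcard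
  lia

theorem counterGame_memory_le {t : ℚ} {σ : (counterGame U).Strategy .one}
    (hσ : WinsOne 0 ((counterGame U).AEL t) σ) {k : ℕ} (hk : σ.HasMemory k) : U + 1 ≤ k := by
  obtain ⟨A, hA⟩ := hk
  obtain ⟨σ₂⟩ := nonempty_strategy_of_states_eq_empty (counterGame_states_two U) 0
  obtain ⟨h0, hcons, -⟩ := outcome_spec 0 σ σ₂
  exact counterGame_le_card_memory (hσ σ₂) h0 (hcons.follows hA fun _ => rfl)

end CounterGame

section MemorylessPlays

variable {S : Type*} {G : Game S} {s : S} {n : ℕ}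

open Game

namespace Game.Play

theorem hasWalk (ρ : G.Play) {i j : ℕ} (hij : i ≤ j) :
    HasWalk G.edge G.weight (ρ.state i) (ρ.state j) (j - i) (ρ.energy j - ρ.energy i) := by
  have h := HasWalk.of_segment (R := G.edge) G.weight ρ.state hij fun n _ _ => ρ.step n
  rwa [sum_Ico_eq_sub _ hij] at h

theorem exists_iterate {f : S → S} {s₀ : S} (hf : ∀ n, G.edge (f^[n] s₀) (f^[n + 1] s₀)) :
    ∃ π : G.Play, π.IsGenerated Unit ∧ ∀ n, π.state n = f^[n] s₀ :=
  ⟨⟨fun n => f^[n] s₀, hf⟩, isGenerated_unit fun n => Function.iterate_succ_apply' f n s₀,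
    fun _ => rfl⟩

end Game.Play

theorem exists_play_avgEnergy_eq_top (h : HasPositiveLasso G.edge G.weight s n) :
    ∃ π : G.Play, π.state 0 = s ∧ π.IsGenerated Unit ∧ π.avgEnergy = ⊤ := by
  obtain ⟨f, hf, htendsto⟩ := h.exists_iterate_tendsto_atTop
  obtain ⟨π, hgen, hπ⟩ := Play.exists_iterate hf
  simp only [← hπ] at htendsto
  exact ⟨π, hπ 0, hgen, π.avgEnergy_eq_top_of_tendsto_atTop htendsto⟩

theorem exists_play_notMem_lowerBounded
    (h : HasPositiveLasso G.edge (fun s s' => -G.weight s s') s n) :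
    ∃ π : G.Play, π.state 0 = s ∧ π.IsGenerated Unit ∧ π ∉ G.lowerBounded 0 := by
  obtain ⟨f, hf, htendsto⟩ := h.exists_iterate_tendsto_atTop
  obtain ⟨π, hgen, hπ⟩ := Play.exists_iterate hf
  obtain ⟨m, hm⟩ := (htendsto.eventually_gt_atTop 0).exists
  refine ⟨π, hπ 0, hgen, fun hnonneg => (hnonneg m).not_gt ?_⟩
  simpa [← hπ, Play.energy] using hm

theorem exists_play_notMem_lowerBounded_of_hasWalk {b : S} {x : ℤ}
    (h : HasWalk G.edge G.weight s b n x) (hx : x < 0) :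
    ∃ π : G.Play, π.state 0 = s ∧ π.IsGenerated Unit ∧ π ∉ G.lowerBounded 0 := by
  rcases h.neg.exists_injective_or_hasPositiveLasso (neg_pos.2 hx) with
    ⟨r, m, rfl, hR, hinj, hm⟩ | ⟨m, hlasso⟩
  · choose f₀ hf₀ using G.total
    obtain ⟨f, hfr, hf⟩ := exists_map_eq_succ_of_injective hinj hR f₀
    obtain ⟨π, hgen, hπ⟩ := Play.exists_iterate (G := G) (f := f) (s₀ := r 0)
      fun i => Function.iterate_succ_apply' f i _ ▸ hf _ (hf₀ _)
    have hstate : ∀ i ≤ m, π.state i = r i := fun i hi =>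
      (hπ i).trans (iterate_eq_of_map_eq_succ hfr hi)
    refine ⟨π, hπ 0, hgen, fun hnonneg => (hnonneg m).not_gt ?_⟩
    have henergy : π.energy m = ∑ i ∈ range m, G.weight (r i) (r (i + 1)) :=
      sum_congr rfl fun i hi => by
        rw [hstate i (mem_range.1 hi).le, hstate (i + 1) (mem_range.1 hi)]
    simpa [henergy] using hm
  · exact exists_play_notMem_lowerBounded hlasso

theorem exists_play_le_avgEnergy {ε : S → ℤ} (hs : ε s = 0) {t : ℝ}
    (h : HasPositiveLasso (fun s s' => G.edge s s' ∧ ε s' = ε s + G.weight s s')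
      (fun s _ => (ε s : ℝ) - t) s n) :
    ∃ π : G.Play, π.state 0 = s ∧ π.IsGenerated Unit ∧ (t : EReal) ≤ π.avgEnergy := by
  obtain ⟨f, hf, htendsto⟩ := h.exists_iterate_tendsto_atTop
  obtain ⟨π, hgen, hπ⟩ := Play.exists_iterate fun n => (hf n).1
  refine ⟨π, hπ 0, hgen, π.le_avgEnergy_of_tendsto_atTop ?_⟩
  have henergy : ∀ i, π.energy i = ε (π.state i) := by
    intro i
    induction i with
    | zero => rw [π.energy_zero, hπ 0, ← hs]; rfl
    | succ i ih => rw [π.energy_succ, ih, hπ i, hπ (i + 1), (hf i).2]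
  simpa only [henergy, hπ] using htendsto

theorem exists_play_lt_avgEnergy [Finite S] {ρ : G.Play}
    (hpot : Function.FactorsThrough ρ.energy ρ.state) {t : ℝ} (ht : (t : EReal) < ρ.avgEnergy) :
    ∃ π : G.Play, π.state 0 = ρ.state 0 ∧ π.IsGenerated Unit ∧ (t : EReal) < π.avgEnergy := by
  obtain ⟨t', htt', ht'⟩ := EReal.lt_iff_exists_real_btwn.1 ht
  let ε : S → ℤ := Function.extend ρ.state ρ.energy 0
  have hε : ∀ n, ε (ρ.state n) = ρ.energy n := hpot.extend_apply 0
  have hunbdd : ¬ BddAbove (Set.range fun n => ∑ i ∈ range n, ((ε (ρ.state i) : ℝ) - t')) := by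
    simp only [hε]
    exact fun hbdd => (ρ.avgEnergy_le_of_bddAbove hbdd).not_gt ht'
  obtain ⟨i, j, hij, heq, -, hpos⟩ := exists_return_of_not_bddAbove ρ.state
    (fun s => (ε s : ℝ) - t') (Set.toFinite _) hunbdd
  have hstep : ∀ n, G.edge (ρ.state n) (ρ.state (n + 1)) ∧
      ε (ρ.state (n + 1)) = ε (ρ.state n) + G.weight (ρ.state n) (ρ.state (n + 1)) := fun n =>
    ⟨ρ.step n, by rw [hε, hε, ρ.energy_succ]⟩
  have walk {i j : ℕ} (hij : i ≤ j) :=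
    HasWalk.of_segment (R := fun s s' => G.edge s s' ∧ ε s' = ε s + G.weight s s')
      (fun s _ => (ε s : ℝ) - t') ρ.state hij fun n _ _ => hstep n
  have hcycle := walk hij.le
  rw [← heq] at hcycle
  obtain ⟨π, h0, hgen, hπ⟩ := exists_play_le_avgEnergy
    ((hε 0).trans ρ.energy_zero) ⟨_, _, _, _, _, walk i.zero_le, hcycle, hpos, rfl⟩
  exact ⟨π, h0, hgen, htt'.trans_le hπ⟩

-- If two visits of a state have different energies, the cycle between them drives the energy to
-- `±∞`; otherwise the energy is a function of the state, and average-energy becomes mean-payoff.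
theorem exists_play_notMem_AEL [Finite S] {t : ℚ} {ρ : G.Play} (hρ : ρ ∉ G.AEL t) :
    ∃ π : G.Play, π.state 0 = ρ.state 0 ∧ π.IsGenerated Unit ∧ π ∉ G.AEL t := by
  by_cases hnonneg : ρ ∈ G.lowerBounded 0
  swap
  · obtain ⟨n, hn⟩ := not_forall.1 hnonneg
    obtain ⟨π, h0, hgen, hπ⟩ := exists_play_notMem_lowerBounded_of_hasWalk
      (ρ.hasWalk n.zero_le) (by simpa [ρ.energy_zero] using hn)
    exact ⟨π, h0, hgen, fun h => hπ h.1⟩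
  have havg : ((t : ℝ) : EReal) < ρ.avgEnergy := lt_of_not_ge fun h => hρ ⟨hnonneg, h⟩
  by_cases hpot : Function.FactorsThrough ρ.energy ρ.state
  · obtain ⟨π, h0, hgen, hπ⟩ := exists_play_lt_avgEnergy hpot havg
    exact ⟨π, h0, hgen, fun h => hπ.not_ge h.2⟩
  obtain ⟨i, j, hij, heq, hne⟩ : ∃ i j, i < j ∧ ρ.state i = ρ.state j ∧
      ρ.energy i ≠ ρ.energy j := by
    contrapose! hpot
    intro i j heq
    rcases lt_trichotomy i j with hij | rfl | hij
    · exact hpot i j hij heq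
    · rfl
    · exact (hpot j i hij heq.symm).symm
  have hstem := ρ.hasWalk i.zero_le
  have hcycle := ρ.hasWalk hij.le
  rw [← heq] at hcycle
  rcases hne.lt_or_gt with hlt | hgt
  · obtain ⟨π, h0, hgen, hπ⟩ :=
      exists_play_avgEnergy_eq_top ⟨_, _, _, _, _, hstem, hcycle, sub_pos.2 hlt, rfl⟩
    exact ⟨π, h0, hgen, fun h => (EReal.coe_lt_top (t : ℝ)).not_ge (hπ ▸ h.2)⟩
  · obtain ⟨π, h0, hgen, hπ⟩ := exists_play_notMem_lowerBounded
      ⟨_, _, _, _, _, hstem.neg, hcycle.neg, neg_pos.2 (sub_neg.2 hgt), rfl⟩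
    exact ⟨π, h0, hgen, fun h => hπ h.1⟩

theorem exists_winsTwo_memoryless [Finite S] (h1 : G.states .one = ∅) {t : ℚ} {ρ : G.Play}
    (hρ : ρ ∉ G.AEL t) :
    ∃ σ : G.Strategy .two, WinsTwo (ρ.state 0) (G.AEL t) σ ∧ σ.Memoryless := by
  obtain ⟨π, h0, hgen, hπ⟩ := exists_play_notMem_AEL hρ
  obtain ⟨σ, hσ, A, hA⟩ := exists_winsTwo_of_isGenerated h1 hπ hgen
  exact ⟨σ, h0 ▸ hσ, hA.memoryless⟩

end MemorylessPlays

end AvgEnergy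

open AvgEnergy AvgEnergy.Game in
theorem mainTheorem9 :
    -- pseudo-polynomial memory suffices for player 1
    (∃ p : MvPolynomial (Fin 3) ℕ,
      ∀ (S : Type*) [Fintype S] (G : Game S), G.OnePlayer → ∀ (s₀ : S) (t : ℚ),
        (∃ σ : G.Strategy .one, WinsOne s₀ (G.AEL t) σ) →
        ∃ (σ : G.Strategy .one) (k : ℕ), WinsOne s₀ (G.AEL t) σ ∧ σ.HasMemory k ∧
          k ≤ MvPolynomial.eval ![Fintype.card S, G.maxWeight, ⌈t⌉₊] p) ∧
    -- pseudo-polynomial memory is necessary for player 1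
    (∀ U : ℕ, 1 ≤ U → ∃ (G : Game (Fin 2)) (s₀ : Fin 2) (t : ℚ),
      G.states .two = ∅ ∧ G.maxWeight = U ∧ t = (U * (U + 1) : ℚ) / (2 * U + 1) ∧
      (∃ σ : G.Strategy .one, WinsOne s₀ (G.AEL t) σ) ∧
      ∀ σ : G.Strategy .one, WinsOne s₀ (G.AEL t) σ → ∀ k : ℕ, σ.HasMemory k → U + 1 ≤ k) ∧
    -- memoryless strategies suffice for player 2
    (∀ (S : Type*) [Fintype S] (G : Game S), G.OnePlayer → ∀ (s₀ : S) (t : ℚ),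
      (∃ σ : G.Strategy .two, WinsTwo s₀ (G.AEL t) σ) →
      ∃ σ : G.Strategy .two, WinsTwo s₀ (G.AEL t) σ ∧ σ.Memoryless) := by
  refine ⟨⟨.X 0 * (.X 2 + 1 + .X 1 + .X 0 ^ 2 * (.X 1 + 1) ^ 2 + 1) + 1, ?_⟩, ?_, ?_⟩
  · rintro S _ G hG s₀ t ⟨σ, hσ⟩
    rcases hG with h1 | h2
    · let A : MooreMachine S (Fin 1) := ⟨0, fun m _ => m, fun _ s => s⟩
      exact ⟨σ, 1, hσ, ⟨A, σ.encodedBy_of_states_eq_empty h1 A⟩, by simp⟩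
    · obtain ⟨σ₂⟩ := nonempty_strategy_of_states_eq_empty h2 s₀
      obtain ⟨τ, hτ, hmemory⟩ := exists_winsOne_hasMemory h2 (hσ σ₂)
      rw [(outcome_spec s₀ σ σ₂).1] at hτ
      exact ⟨τ, _, hτ, hmemory, by simp⟩
  · intro U hU
    exact ⟨counterGame U, 0, _, counterGame_states_two U, counterGame_maxWeight hU, rfl,
      counterGame_exists_winsOne U, fun σ hσ k hk => counterGame_memory_le hσ hk⟩
  · rintro S _ G hG s₀ t ⟨σ, hσ⟩
    rcases hG with h1 | h2
    · obtain ⟨σ₁⟩ := nonempty_strategy_of_states_eq_empty h1 s₀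
      rw [← (outcome_spec s₀ σ₁ σ).1]
      exact exists_winsTwo_memoryless h1 (hσ σ₁)
    · let A : MooreMachine S Unit := ⟨(), fun _ _ => (), fun _ s => s⟩
      exact ⟨σ, hσ, (σ.encodedBy_of_states_eq_empty h2 A).memoryless⟩
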